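/- Let $\mathcal H$ be a separable complex Hilbert space and let $A,B,C,W$ be bounded linear operators on $\mathcal H$ such that $A$ and $B$ have closed range and $W$ is positive (semidefinite). Write $R(\cdot)$ and $N(\cdot)$ for range and kernel. For $1\le p<\infty$, a compact operator $T$ belongs to the Schatten class $S_p$ if $\sum_k\lambda_k(T)^p<\infty$, where $\lambda_k(T)$ are the eigenvalues of $|T|=(T^*T)^{1/2}$ repeated according to multiplicity; in this case $\|T\|_p=\bigl(\sum_k\lambda_k(T)^p\bigr)^{1/p}$. For a subspace $\mathcal S$ put $\mathcal S^{\perp_W}=\{x\in\mathcal H:\langle Wx,y\rangle=0\text{ for all }y\in\mathcal S\}$, and for a closed subspace $\mathcal S$ let $W_{/\mathcal S}=\max\{X: 0\le X\le W,\ R(X)\subseteq\mathcal S^{\perp}\}$ be the shorted operator of $W$ to $\mathcal S$, the maximum being taken in the order $X\le Y\iff Y-X$ is positive (this maximum exists). Suppose that $W^{1/2}\in S_p$ for some $p$ with $1\le p<\infty$, and that $$N(B)\subseteq N(A^*WC)\quad\text{and}\quad R(C)\subseteq R(A)+R(A)^{\perp_W}.$$ Then $W^{1/2}(AXB-C)\in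 S_p$ for every bounded operator $X$ on $\mathcal H$, $(W_{/R(A)})^{1/2}C\in S_p$, and there exists a bounded operator $X_0$ on $\mathcal H$ such that $$\min_{X}\|W^{1/2}(AXB-C)\|_p=\|W^{1/2}(AX_0B-C)\|_p=\|(W_{/R(A)})^{1/2}C\|_p,$$ where the minimum is taken over all bounded operators $X$ on $\mathcal H$. -/

import Mathlib

open scoped ENNReal NNReal

noncomputable section

namespace WeightedLS

variable {H : Type*} [NormedAddCommGroup H] [InnerProductSpace ℂ H] [CompleteSpace H]

/-- The `W`-orthogonal complement of a subspace `S`: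
all `x` with `⟪W x, y⟫ = 0` for every `y ∈ S`. -/
def wOrthogonal (W : H →L[ℂ] H) (S : Submodule ℂ H) : Submodule ℂ H where
  carrier := {x | ∀ y ∈ S, inner ℂ (W x) y = 0}
  add_mem' := by
    intro a b ha hb y hy
    rw [map_add, inner_add_left, ha y hy, hb y hy, add_zero]
  zero_mem' := by
    intro y _
    rw [map_zero, inner_zero_left]
  smul_mem' := by
    intro c x hx y hy
    rw [map_smul, inner_smul_left, hx y hy, mul_zero]

/-- The set of operators `X` with `0 ≤ X ≤ W` (Loewner order) whose range lies in `Sᗮ`. -/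
def shortedSet (W : H →L[ℂ] H) (S : Submodule ℂ H) : Set (H →L[ℂ] H) :=
  {X | 0 ≤ X ∧ X ≤ W ∧ X.range ≤ Sᗮ}

/-- For a positive operator `W` the set `shortedSet W S` has a maximum, so that the shorted
operator defined below is meaningful. -/
theorem exists_isGreatest_shortedSet {W : H →L[ℂ] H} (hW : 0 ≤ W) (S : Submodule ℂ H) :
    ∃ M, IsGreatest (shortedSet W S) M := by
  set R : H →L[ℂ] H := CFC.sqrt W with hR
  have hR0 : 0 ≤ R := CFC.sqrt_nonneg W
  have hRsa : ∀ x y, inner ℂ (R x) y = inner ℂ x (R y) := by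
    intro x y
    exact ((ContinuousLinearMap.nonneg_iff_isPositive R).1 hR0).inner_left_eq_inner_right x y
  have hRR : ∀ x, R (R x) = W x := by
    intro x
    have h := CFC.sqrt_mul_sqrt_self W hW
    exact congrArg (fun T : H →L[ℂ] H => T x) h
  set N : Submodule ℂ H := S.map (R : H →ₗ[ℂ] H) with hN
  set P : H →L[ℂ] H := (Nᗮ).starProjection with hP
  have hPmem : ∀ x, P x ∈ Nᗮ := fun x => Submodule.starProjection_apply_mem _ x
  have hPsub : ∀ x, x - P x ∈ Nᗮᗮ := fun x => Submodule.sub_starProjection_mem_orthogonal x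
  have hPP : ∀ x, inner ℂ (P x) x = inner ℂ (P x) (P x) := by
    intro x
    have h := Submodule.inner_right_of_mem_orthogonal (hPmem x) (hPsub x)
    rw [inner_sub_right, sub_eq_zero] at h
    exact h
  have key : ∀ x, inner ℂ ((R ∘L P ∘L R) x) x = ((‖P (R x)‖ ^ 2 : ℝ) : ℂ) := by
    intro x
    have h1 : inner ℂ ((R ∘L P ∘L R) x) x = inner ℂ (P (R x)) (R x) := hRsa _ _
    rw [h1, hPP, inner_self_eq_norm_sq_to_K]
    norm_cast
  have keyW : ∀ x, inner ℂ (W x) x = ((‖R x‖ ^ 2 : ℝ) : ℂ) := by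
    intro x
    rw [← hRR, hRsa, inner_self_eq_norm_sq_to_K]
    norm_cast
  refine ⟨R ∘L P ∘L R, ⟨?_, ?_, ?_⟩, ?_⟩
  · rw [ContinuousLinearMap.nonneg_iff_isPositive, ContinuousLinearMap.isPositive_iff_complex]
    intro x
    rw [key x]
    refine ⟨congrArg Complex.ofReal (Complex.ofReal_re _), ?_⟩
    simp only [RCLike.re_to_complex, Complex.ofReal_re]
    positivity
  · rw [ContinuousLinearMap.le_def, ContinuousLinearMap.isPositive_iff_complex]
    intro x
    rw [sub_apply, inner_sub_left, key x, keyW x, ← Complex.ofReal_sub]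
    refine ⟨congrArg Complex.ofReal (Complex.ofReal_re _), ?_⟩
    simp only [RCLike.re_to_complex, Complex.ofReal_re]
    have h : ‖P (R x)‖ ≤ ‖R x‖ := Submodule.norm_starProjection_apply_le _ _
    have h0 := norm_nonneg (P (R x))
    nlinarith
  · rintro _ ⟨x, rfl⟩
    rw [Submodule.mem_orthogonal']
    intro s hs
    have h1 : inner ℂ ((R ∘L P ∘L R) x) s = inner ℂ (P (R x)) (R s) := hRsa _ _
    refine h1.trans ?_
    exact Submodule.inner_left_of_mem_orthogonal (Submodule.mem_map_of_mem hs) (hPmem _)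
  · rintro X ⟨hX0, hXW, hXS⟩
    have hXp := (ContinuousLinearMap.nonneg_iff_isPositive X).1 hX0
    have hXker : ∀ s ∈ S, X s = 0 := by
      intro s hs
      have h : inner ℂ (X s) (X s) = 0 := by
        rw [hXp.inner_left_eq_inner_right]
        exact Submodule.inner_right_of_mem_orthogonal hs (hXS ⟨X s, rfl⟩)
      exact inner_self_eq_zero.1 h
    have hre : ∀ x, ((inner ℂ (X x) x).re : ℂ) = inner ℂ (X x) x := fun x =>
      ((ContinuousLinearMap.isPositive_iff_complex X).1 hXp x).1
    rw [ContinuousLinearMap.le_def, ContinuousLinearMap.isPositive_iff_complex]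
    intro x
    rw [sub_apply, inner_sub_left, key x, ← hre x, ← Complex.ofReal_sub]
    refine ⟨congrArg Complex.ofReal (Complex.ofReal_re _), ?_⟩
    simp only [RCLike.re_to_complex, Complex.ofReal_re]
    have hcl : IsClosed {z : H | (inner ℂ (X x) x).re ≤ ‖R x - z‖ ^ 2} :=
      isClosed_le continuous_const (by fun_prop)
    have hsub : (N : Set H) ⊆ {z : H | (inner ℂ (X x) x).re ≤ ‖R x - z‖ ^ 2} := by
      rintro _ ⟨s, hs, rfl⟩
      have h1 : inner ℂ (X (x - s)) (x - s) = inner ℂ (X x) x := by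
        rw [map_sub, hXker s hs, sub_zero, inner_sub_right, hXp.inner_left_eq_inner_right x s,
          hXker s hs, inner_zero_right, sub_zero]
      have h2 := ((ContinuousLinearMap.isPositive_iff_complex _).1
        ((ContinuousLinearMap.le_def _ _).1 hXW) (x - s)).2
      rw [sub_apply, inner_sub_left, h1, keyW, map_sub] at h2
      simp only [RCLike.re_to_complex, Complex.ofReal_re, map_sub] at h2
      show (inner ℂ (X x) x).re ≤ ‖R x - R s‖ ^ 2
      linarith
    have hmem : R x - P (R x) ∈ closure (N : Set H) := by
      have h := hPsub (R x)
      rw [Submodule.orthogonal_orthogonal_eq_closure] at h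
      exact h
    have h3 : (inner ℂ (X x) x).re ≤ ‖R x - (R x - P (R x))‖ ^ 2 :=
      closure_minimal hsub hcl hmem
    rw [sub_sub_cancel] at h3
    linarith

open Classical in
/-- The shorted operator `W_{/S} = max {X : 0 ≤ X ≤ W, R(X) ⊆ Sᗮ}` of a positive operator `W`
to the subspace `S` (and `0` if there is no maximum, which does not happen for positive `W`). -/
def shortedOperator (W : H →L[ℂ] H) (S : Submodule ℂ H) : H →L[ℂ] H :=
  if h : ∃ M, IsGreatest (shortedSet W S) M then h.choose else 0

theorem shortedOperator_isGreatest {W : H →L[ℂ] H} (hW : 0 ≤ W) (S : Submodule ℂ H) :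
    IsGreatest (shortedSet W S) (shortedOperator W S) := by
  have h := exists_isGreatest_shortedSet hW S
  rw [shortedOperator, dif_pos h]
  exact h.choose_spec

/-- The sum of the `p`-th powers of the eigenvalues of `|T| = (T* T)^{1/2}`, each eigenvalue being
repeated according to its multiplicity, i.e. the dimension of its eigenspace. (A number `μ` that is
not an eigenvalue has multiplicity `0`, the eigenvalue `0` contributes `0` for `p > 0`, and the
nonzero eigenvalues of a compact operator have finite multiplicity.) -/
def schattenSum (p : ℝ) (T : H →L[ℂ] H) : ℝ≥0∞ :=
  ∑' μ : ℝ≥0,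
    (Module.finrank ℂ
      (Module.End.eigenspace ((CFC.abs T : H →L[ℂ] H) : H →ₗ[ℂ] H) ((μ : ℝ) : ℂ)) : ℝ≥0∞) *
      (μ : ℝ≥0∞) ^ p

/-- `T` belongs to the Schatten class `S_p`: it is compact and the sum of the `p`-th powers of the
eigenvalues of `|T|` is finite. -/
def MemSchatten (p : ℝ) (T : H →L[ℂ] H) : Prop :=
  IsCompactOperator T ∧ schattenSum p T < ∞

/-- The Schatten norm `‖T‖_p` of an operator `T` in the Schatten class `S_p`. -/
def schattenNorm (p : ℝ) (T : H →L[ℂ] H) : ℝ :=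
  (schattenSum p T).toReal ^ (1 / p)

/-- The seminorm `‖X‖_{p,W} = ‖W^{1/2} X‖_p`. -/
def schattenSeminorm (p : ℝ) (W X : H →L[ℂ] H) : ℝ :=
  schattenNorm p (CFC.sqrt W * X)

end WeightedLS

end

/-! The range inclusion and the kernel inclusion make the normal equation `A* W A X B = A* W C`
solvable (Douglas' lemma, plus a generalized inverse of `B`). For a solution `X₀` the residual `E =
A X₀ B - C` maps into the `W`-orthogonal complement of `R(A)`. Since `A X B - C` differs from `E` by
an operator into `R(A)`, Pythagoras gives `‖W^{1/2} E x‖ ≤ ‖W^{1/2} (A X B - C) x‖` for each vector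
`x`; since `-C` also differs from `E` by such an operator, the shorted operator satisfies
`‖(W_{/R(A)})^{1/2} C x‖ = ‖W^{1/2} E x‖`.

It remains to pass from vectors to Schatten norms: `‖T x‖ ≤ ‖S x‖` for all `x` implies `‖T‖_p ≤
‖S‖_p`. A min-max argument compares the numbers of eigenvalues of `|T|` and `|S|` above each level
`t` (`eigenvalueTail_le`), and the layer-cake formula integrates this over `t` (`tsum_mul_rpow_le`).
-/

namespace WeightedLS

/-! ### Eigenvalue counting for compact positive operators -/

section Compact

variable {H : Type*} [NormedAddCommGroup H] [InnerProductSpace ℂ H]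

theorem isCompactOperator_of_norm_le [CompleteSpace H] {S T : H →L[ℂ] H} (hS : IsCompactOperator S)
    (h : ∀ x, ‖T x‖ ≤ ‖S x‖) : IsCompactOperator T := by
  have hS' := (isCompactOperator_iff_isCompact_closure_image_closedBall
    (S : H →ₗ[ℂ] H) one_pos).1 hS
  refine (isCompactOperator_iff_isCompact_closure_image_closedBall
    (T : H →ₗ[ℂ] H) one_pos).2 (TotallyBounded.isCompact_of_isClosed ?_ isClosed_closure)
  refine TotallyBounded.closure ?_
  have htb : TotallyBounded ((S : H →ₗ[ℂ] H) '' Metric.closedBall 0 1) :=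
    hS'.totallyBounded.subset subset_closure
  rw [Metric.totallyBounded_iff]
  intro ε hε
  -- The net has centres `S y`, so the same points `y` give a net for the image under `T`.
  obtain ⟨v, -, hvfin, hcov⟩ := Set.exists_subset_image_finite_and.1
    (totallyBounded_iff_subset.1 htb _ (Metric.dist_mem_uniformity hε))
  refine ⟨(T : H →ₗ[ℂ] H) '' v, hvfin.image _, ?_⟩
  rintro _ ⟨x, hx, rfl⟩
  obtain ⟨_, ⟨y, hy, rfl⟩, hd⟩ := Set.mem_iUnion₂.1 (hcov (Set.mem_image_of_mem _ hx))
  refine Set.mem_iUnion₂.2 ⟨_, Set.mem_image_of_mem _ hy, ?_⟩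
  have hd' : dist (S x) (S y) < ε := hd
  rw [dist_eq_norm, ← map_sub] at hd'
  change dist (T x) (T y) < ε
  rw [dist_eq_norm, ← map_sub]
  exact (h _).trans_lt hd'

/-- The eigenspace of `K` for the nonnegative real number `μ`. -/
abbrev nnEigenspace (K : H →L[ℂ] H) (μ : ℝ≥0) : Submodule ℂ H :=
  Module.End.eigenspace (K : H →ₗ[ℂ] H) ((μ : ℝ) : ℂ)

-- The vectors orthogonal to all these eigenspaces form a closed invariant subspace `M`. The norm of
-- the compact positive restriction `K'` is one of its eigenvalues; were it at least `t`, an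
-- eigenvector in `M` would be orthogonal to itself.
open scoped ComplexOrder in
theorem norm_apply_lt_of_orthogonal_eigenspaces [CompleteSpace H] {K : H →L[ℂ] H}
    (hK : IsCompactOperator K) (hpos : K.IsPositive) {t : ℝ} (ht : 0 < t) {x : H} (hx0 : x ≠ 0)
    (hx : ∀ μ : ℝ≥0, t ≤ μ → x ∈ (nnEigenspace K μ)ᗮ) : ‖K x‖ < t * ‖x‖ := by
  have hsym : (K : H →ₗ[ℂ] H).IsSymmetric := hpos.isSymmetric
  set M : Submodule ℂ H := ⨅ μ : {μ : ℝ≥0 // t ≤ μ}, (nnEigenspace K μ)ᗮ with hM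
  have hMcl : IsClosed (M : Set H) := by
    rw [hM, Submodule.coe_iInf]
    exact isClosed_iInter fun _ => Submodule.isClosed_orthogonal _
  have : CompleteSpace M := hMcl.completeSpace_coe
  have hinv : ∀ v ∈ M, (K : H →ₗ[ℂ] H) v ∈ M := by
    intro v hv
    rw [hM, Submodule.mem_iInf] at hv ⊢
    exact fun μ => hsym.invariant_orthogonalComplement_eigenspace _ v (hv μ)
  have hxM : x ∈ M := by
    rw [hM, Submodule.mem_iInf]
    exact fun μ => hx μ μ.2
  let K' : M →L[ℂ] M := K.restrict hinv
  have hK' : IsCompactOperator K' := hK.restrict' hinv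
  have hsym' : K'.IsSymmetric := hsym.restrict_invariant hinv
  have : Nontrivial M := ⟨⟨x, hxM⟩, 0, fun h => hx0 (congrArg Subtype.val h)⟩
  have hnorm : ‖K'‖ < t := by
    by_contra! hle
    obtain ⟨k, hk, hkn⟩ := spectrum.exists_nnnorm_eq_spectralRadius K'
    rw [K'.spectralRadius_eq_nnnorm hsym'.isSelfAdjoint] at hkn
    have hkn' : ‖k‖ = ‖K'‖ := congrArg NNReal.toReal (ENNReal.coe_injective hkn)
    have hk0 : k ≠ 0 := by
      rintro rfl
      rw [norm_zero] at hkn'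
      linarith
    obtain ⟨v, hv, hv0⟩ := ((hK'.hasEigenvalue_iff_mem_spectrum hk0).2 hk).exists_hasEigenvector
    rw [Module.End.mem_eigenspace_iff] at hv
    have hv' : K (v : H) = k • (v : H) := congrArg Subtype.val hv
    have hv0' : (v : H) ≠ 0 := fun h => hv0 (Subtype.ext h)
    have hin := hpos.inner_nonneg_right (v : H)
    rw [hv', inner_smul_right, inner_self_eq_norm_sq_to_K] at hin
    have hkpos : 0 ≤ k := by
      have hc : 0 < ‖(v : H)‖ ^ 2 := pow_pos (norm_pos_iff.2 hv0') 2
      have hin' : 0 ≤ k * ((‖(v : H)‖ ^ 2 : ℝ) : ℂ) := by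
        push_cast
        exact hin
      rw [Complex.nonneg_iff, Complex.re_mul_ofReal, Complex.im_mul_ofReal] at hin'
      exact Complex.nonneg_iff.2 ⟨nonneg_of_mul_nonneg_left hin'.1 hc,
        ((mul_eq_zero.1 hin'.2.symm).resolve_right hc.ne').symm⟩
    have hkk : ((‖k‖₊ : ℝ) : ℂ) = k := by
      rw [coe_nnnorm]
      exact Complex.norm_of_nonneg' hkpos
    have hmem : (v : H) ∈ nnEigenspace K ‖k‖₊ := by
      rw [Module.End.mem_eigenspace_iff, hkk]
      exact hv'
    have hort := (Submodule.mem_iInf _).1 v.2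
    have hz := hort ⟨‖k‖₊, by rw [coe_nnnorm, hkn']; exact hle⟩ _ hmem
    exact hv0' (inner_self_eq_zero.1 hz)
  have h1 : ‖K x‖ ≤ ‖K'‖ * ‖x‖ := K'.le_opNorm ⟨x, hxM⟩
  exact h1.trans_lt (mul_lt_mul_of_pos_right hnorm (norm_pos_iff.2 hx0))

/-- The number of eigenvalues `μ` of `K` with `t ≤ μ`, counted with multiplicity. -/
noncomputable def eigenvalueTail (K : H →L[ℂ] H) (t : ℝ) : ℝ≥0∞ :=
  ∑' μ : ℝ≥0, Set.indicator {μ : ℝ≥0 | t ≤ μ}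
    (fun μ => (Module.finrank ℂ (nnEigenspace K μ) : ℝ≥0∞)) μ

/-- Upper half of min-max: a vector of the image of `L` orthogonal to all eigenspaces with `μ ≥ t`
must vanish, so projecting onto those eigenspaces is injective. -/
theorem finrank_le_eigenvalueTail [CompleteSpace H] {K : H →L[ℂ] H} (hK : IsCompactOperator K)
    (hpos : K.IsPositive) {t : ℝ} (ht : 0 < t) {V : Type*} [AddCommGroup V] [Module ℂ V]
    (L : V →ₗ[ℂ] H) (hL : Function.Injective L)
    (h : ∀ v, t * ‖L v‖ ≤ ‖K (L v)‖) : (Module.finrank ℂ V : ℝ≥0∞) ≤ eigenvalueTail K t := by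
  have hfd : ∀ μ : ℝ≥0, t ≤ μ → FiniteDimensional ℂ (nnEigenspace K μ) := by
    intro μ hμ
    refine ContinuousLinearMap.finite_dimensional_eigenspace hK _ ?_
    exact_mod_cast (ht.trans_le hμ).ne'
  rcases eq_or_ne (eigenvalueTail K t) ∞ with htop | htop
  · rw [htop]; exact le_top
  -- Multiplicities are integers, so a finite tail leaves only finitely many nontrivial eigenspaces.
  have hfin := ENNReal.finite_const_le_of_tsum_ne_top htop one_ne_zero
  set F : Finset ℝ≥0 := hfin.toFinset with hF
  have hFt : ∀ μ ∈ F, t ≤ μ := by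
    intro μ hμ
    rw [hF, Set.Finite.mem_toFinset, Set.mem_ofPred_eq] at hμ
    by_contra hlt
    rw [Set.indicator_of_notMem (by exact hlt)] at hμ
    simp at hμ
  have hFc : ∀ μ : ℝ≥0, t ≤ μ → μ ∉ F → nnEigenspace K μ = ⊥ := by
    intro μ hμ hμF
    have := hfd μ hμ
    rw [hF, Set.Finite.mem_toFinset, Set.mem_ofPred_eq, Set.indicator_of_mem (by exact hμ)] at hμF
    rw [← Submodule.finrank_eq_zero (R := ℂ)]
    by_contra hne
    exact hμF (by exact_mod_cast Nat.one_le_iff_ne_zero.2 hne)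
  have : ∀ μ : F, FiniteDimensional ℂ (nnEigenspace K μ) := fun μ => hfd μ (hFt μ μ.2)
  let P : V →ₗ[ℂ] (∀ μ : F, nnEigenspace K μ) :=
    LinearMap.pi fun μ => ((nnEigenspace K (μ : ℝ≥0)).orthogonalProjectionOnto : H →ₗ[ℂ] _) ∘ₗ L
  have hP : Function.Injective P := by
    rw [injective_iff_map_eq_zero]
    intro v hv
    by_contra hv0
    have hL0 : L v ≠ 0 := fun h0 => hv0 (hL (h0.trans (map_zero L).symm))
    refine absurd (h v) (not_le.2 ?_)
    refine norm_apply_lt_of_orthogonal_eigenspaces hK hpos ht hL0 fun μ hμ => ?_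
    by_cases hμF : μ ∈ F
    · have := congrFun hv ⟨μ, hμF⟩
      exact Submodule.orthogonalProjectionOnto_eq_zero_iff.1 this
    · rw [hFc μ hμ hμF, Submodule.bot_orthogonal_eq_top]
      trivial
  have hle := LinearMap.finrank_le_finrank_of_injective hP
  rw [Module.finrank_pi_fintype] at hle
  calc (Module.finrank ℂ V : ℝ≥0∞)
      ≤ ((∑ μ : F, Module.finrank ℂ (nnEigenspace K μ) : ℕ) : ℝ≥0∞) := by exact_mod_cast hle
    _ = ∑ μ ∈ F, Set.indicator {μ : ℝ≥0 | t ≤ μ}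
          (fun μ => (Module.finrank ℂ (nnEigenspace K μ) : ℝ≥0∞)) μ := by
        rw [Nat.cast_sum, ← Finset.sum_coe_sort F]
        refine Finset.sum_congr rfl fun μ _ => ?_
        rw [Set.indicator_of_mem (by exact hFt μ μ.2)]
    _ ≤ eigenvalueTail K t := ENNReal.sum_le_tsum F

/-- On the span of eigenvectors of `K₁` with eigenvalues at least `t`, `t ‖v‖ ≤ ‖K₁ v‖ ≤ ‖K₂ (L
v)‖`. Hence `L` is injective there, and `K₂` is bounded below by `t / c` on the image. -/
theorem eigenvalueTail_le [CompleteSpace H] {K₁ K₂ : H →L[ℂ] H} (hK₁ : IsCompactOperator K₁)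
    (hpos₁ : K₁.IsPositive) (hK₂ : IsCompactOperator K₂) (hpos₂ : K₂.IsPositive) (L : H →L[ℂ] H)
    {c : ℝ} (hc : 0 < c) (hL : ∀ x, ‖L x‖ ≤ c * ‖x‖) (h : ∀ x, ‖K₁ x‖ ≤ ‖K₂ (L x)‖)
    {t : ℝ} (ht : 0 < t) : eigenvalueTail K₁ t ≤ eigenvalueTail K₂ (t / c) := by
  rw [eigenvalueTail, ENNReal.tsum_eq_iSup_sum]
  refine iSup_le fun F => ?_
  classical
  rw [← Finset.sum_filter_add_sum_filter_not F (fun μ : ℝ≥0 => t ≤ μ)]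
  rw [Finset.sum_eq_zero (s := F.filter fun μ : ℝ≥0 => ¬ t ≤ μ), add_zero]
  swap
  · intro μ hμ
    exact Set.indicator_of_notMem (by exact (Finset.mem_filter.1 hμ).2) _
  set G : Finset ℝ≥0 := F.filter fun μ : ℝ≥0 => t ≤ μ with hG
  have hGt : ∀ μ ∈ G, t ≤ μ := fun μ hμ => (Finset.mem_filter.1 hμ).2
  have : ∀ μ : G, FiniteDimensional ℂ (nnEigenspace K₁ μ) := fun μ =>
    ContinuousLinearMap.finite_dimensional_eigenspace hK₁ _
      (by exact_mod_cast (ht.trans_le (hGt μ μ.2)).ne')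
  let J : (∀ μ : G, nnEigenspace K₁ μ) →ₗ[ℂ] H :=
    LinearMap.lsum ℂ (fun μ : G => nnEigenspace K₁ μ) ℂ fun μ => (nnEigenspace K₁ μ).subtype
  have hJ : ∀ v, J v = ∑ μ, (v μ : H) := by
    intro v
    simp [J, LinearMap.lsum_apply]
  have horth : OrthogonalFamily ℂ (fun μ : G => nnEigenspace K₁ μ)
      fun μ => (nnEigenspace K₁ μ).subtypeₗᵢ := by
    refine OrthogonalFamily.comp (γ := G) (f := fun μ : G => (((μ : ℝ≥0) : ℝ) : ℂ))
      (LinearMap.IsSymmetric.orthogonalFamily_eigenspaces hpos₁.isSymmetric) ?_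
    intro μ ν hμν
    simpa using hμν
  have hJn : ∀ v, ‖J v‖ ^ 2 = ∑ μ, ‖v μ‖ ^ 2 := by
    intro v
    rw [hJ]
    exact horth.norm_sum v Finset.univ
  have hKJ : ∀ v, K₁ (J v) = J fun μ => ((μ : ℝ≥0) : ℂ) • v μ := by
    intro v
    rw [hJ, hJ, map_sum]
    refine Finset.sum_congr rfl fun μ _ => ?_
    exact Module.End.mem_eigenspace_iff.1 (v μ).2
  have hlow : ∀ v, t * ‖J v‖ ≤ ‖K₁ (J v)‖ := by
    intro v
    refine (sq_le_sq₀ (by positivity) (norm_nonneg _)).1 ?_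
    rw [mul_pow, hKJ, hJn, hJn, Finset.mul_sum]
    refine Finset.sum_le_sum fun μ _ => ?_
    rw [norm_smul, mul_pow]
    have h1 : ‖(((μ : ℝ≥0) : ℝ) : ℂ)‖ = ((μ : ℝ≥0) : ℝ) := by simp
    rw [h1]
    gcongr
    exact hGt μ μ.2
  have hlow' : ∀ v, t * ‖J v‖ ≤ ‖K₂ (L (J v))‖ := fun v => (hlow v).trans (h _)
  have hinj : Function.Injective ((L : H →ₗ[ℂ] H) ∘ₗ J) := by
    rw [injective_iff_map_eq_zero]
    intro v hv
    have hv' : L (J v) = 0 := hv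
    have h1 := hlow' v
    rw [hv', map_zero, norm_zero] at h1
    have h2 : ‖J v‖ = 0 := le_antisymm (by nlinarith [norm_nonneg (J v)]) (norm_nonneg _)
    have h3 := hJn v
    rw [h2] at h3
    funext μ
    have h4 := (Finset.sum_eq_zero_iff_of_nonneg (fun μ _ => sq_nonneg ‖v μ‖)).1
      (h3.symm.trans (by norm_num)) μ (Finset.mem_univ _)
    simpa using h4
  have hmain := finrank_le_eigenvalueTail hK₂ hpos₂ (div_pos ht hc) _ hinj (by
    intro v
    refine le_trans ?_ (hlow' v)
    rw [div_mul_eq_mul_div, div_le_iff₀ hc, mul_assoc, mul_comm ‖J v‖]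
    exact mul_le_mul_of_nonneg_left (hL _) ht.le)
  rw [Module.finrank_pi_fintype] at hmain
  refine le_trans (le_of_eq ?_) hmain
  rw [Nat.cast_sum, ← Finset.sum_coe_sort G]
  refine Finset.sum_congr rfl fun μ _ => ?_
  rw [Set.indicator_of_mem (by exact hGt μ μ.2)]

end Compact

/-! ### Layer-cake formula and monotonicity of Schatten norms -/

section Schatten

-- Layer-cake formula for the discrete measure with mass `m μ` at each `μ`.
open MeasureTheory in
theorem tsum_mul_rpow_eq_lintegral (m : ℝ≥0 → ℝ≥0∞) {p : ℝ} (hp : 0 < p) {c : ℝ} (hc : 0 < c) :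
    ∑' μ : ℝ≥0, m μ * ENNReal.ofReal ((c * μ) ^ p) =
      ENNReal.ofReal p * ∫⁻ t in Set.Ioi (0 : ℝ),
        (∑' μ : ℝ≥0, Set.indicator {μ : ℝ≥0 | t / c ≤ μ} m μ) * ENNReal.ofReal (t ^ (p - 1)) := by
  set ν : Measure ℝ≥0 := Measure.sum fun μ => m μ • Measure.dirac μ with hν
  have hmeas : Measurable fun μ : ℝ≥0 => c * (μ : ℝ) := by fun_prop
  have h := lintegral_rpow_eq_lintegral_meas_le_mul ν (f := fun μ : ℝ≥0 => c * (μ : ℝ))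
    (Filter.Eventually.of_forall fun μ => by positivity) hmeas.aemeasurable hp
  rw [hν, lintegral_sum_measure] at h
  simp only [lintegral_smul_measure, lintegral_dirac, smul_eq_mul] at h
  rw [h]
  congr 1
  refine lintegral_congr fun t => ?_
  congr 1
  rw [Measure.sum_apply _ (measurableSet_le measurable_const hmeas)]
  refine tsum_congr fun μ => ?_
  simp only [Measure.smul_apply, Measure.dirac_apply, smul_eq_mul, Set.indicator_apply,
    Set.mem_ofPred_eq, Pi.one_apply, div_le_iff₀' hc]
  split_ifs <;> simp

theorem tsum_mul_rpow_le {m₁ m₂ : ℝ≥0 → ℝ≥0∞} {p : ℝ} (hp : 0 < p) {c : ℝ} (hc : 0 < c)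
    (h : ∀ t : ℝ, 0 < t → ∑' μ : ℝ≥0, Set.indicator {μ : ℝ≥0 | t ≤ μ} m₁ μ ≤
      ∑' μ : ℝ≥0, Set.indicator {μ : ℝ≥0 | t / c ≤ μ} m₂ μ) :
    ∑' μ : ℝ≥0, m₁ μ * (μ : ℝ≥0∞) ^ p ≤
      ENNReal.ofReal (c ^ p) * ∑' μ : ℝ≥0, m₂ μ * (μ : ℝ≥0∞) ^ p := by
  have hpow : ∀ μ : ℝ≥0, (μ : ℝ≥0∞) ^ p = ENNReal.ofReal ((μ : ℝ) ^ p) := by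
    intro μ
    rw [← ENNReal.ofReal_rpow_of_nonneg μ.coe_nonneg hp.le, ENNReal.ofReal_coe_nnreal]
  have h1 := tsum_mul_rpow_eq_lintegral m₁ hp one_pos
  have h2 := tsum_mul_rpow_eq_lintegral m₂ hp hc
  simp only [one_mul, div_one] at h1
  have h3 : ENNReal.ofReal (c ^ p) * ∑' μ : ℝ≥0, m₂ μ * (μ : ℝ≥0∞) ^ p =
      ∑' μ : ℝ≥0, m₂ μ * ENNReal.ofReal ((c * μ) ^ p) := by
    rw [← ENNReal.tsum_mul_left]
    refine tsum_congr fun μ => ?_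
    rw [hpow, Real.mul_rpow hc.le μ.coe_nonneg, ENNReal.ofReal_mul (by positivity)]
    ring
  rw [h3, h2]
  simp only [hpow]
  rw [h1]
  gcongr ENNReal.ofReal p * ?_
  refine MeasureTheory.setLIntegral_mono' measurableSet_Ioi fun t ht => ?_
  exact mul_le_mul_left (h t ht) _

variable {H : Type*} [NormedAddCommGroup H] [InnerProductSpace ℂ H]

theorem re_inner_le_of_le {X Y : H →L[ℂ] H} (h : X ≤ Y) (x : H) :
    (inner ℂ (X x) x).re ≤ (inner ℂ (Y x) x).re := by
  have h2 := ((ContinuousLinearMap.isPositive_iff_complex _).1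
    ((ContinuousLinearMap.le_def _ _).1 h) x).2
  rw [sub_apply, inner_sub_left] at h2
  simpa using h2

variable [CompleteSpace H]

theorem norm_apply_eq_of_mul_self_eq {K T : H →L[ℂ] H} (hK : K.IsPositive)
    (h : K * K = ContinuousLinearMap.adjoint T * T) (x : H) : ‖K x‖ = ‖T x‖ := by
  have h1 : inner ℂ (K x) (K x) = inner ℂ (T x) (T x) := by
    rw [← hK.inner_left_eq_inner_right, ← ContinuousLinearMap.adjoint_inner_left]
    exact congrArg (fun S : H →L[ℂ] H => inner ℂ (S x) x) h
  rw [← sq_eq_sq₀ (norm_nonneg _) (norm_nonneg _)]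
  rw [inner_self_eq_norm_sq_to_K, inner_self_eq_norm_sq_to_K] at h1
  exact_mod_cast h1

theorem norm_abs_apply (T : H →L[ℂ] H) (x : H) : ‖(CFC.abs T : H →L[ℂ] H) x‖ = ‖T x‖ :=
  norm_apply_eq_of_mul_self_eq
    ((ContinuousLinearMap.nonneg_iff_isPositive _).1 (CFC.abs_nonneg T)) (CFC.abs_mul_abs T) x

theorem schattenSum_le_of_norm_le {S T : H →L[ℂ] H} (hS : IsCompactOperator S)
    (hT : IsCompactOperator T) (L : H →L[ℂ] H) {c : ℝ} (hc : 0 < c) (hL : ∀ x, ‖L x‖ ≤ c * ‖x‖)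
    (h : ∀ x, ‖T x‖ ≤ ‖S (L x)‖) {p : ℝ} (hp : 0 < p) :
    schattenSum p T ≤ ENNReal.ofReal (c ^ p) * schattenSum p S :=
  tsum_mul_rpow_le hp hc fun _ ht => eigenvalueTail_le
    (isCompactOperator_of_norm_le hT fun x => (norm_abs_apply T x).le)
    ((ContinuousLinearMap.nonneg_iff_isPositive _).1 (CFC.abs_nonneg T))
    (isCompactOperator_of_norm_le hS fun x => (norm_abs_apply S x).le)
    ((ContinuousLinearMap.nonneg_iff_isPositive _).1 (CFC.abs_nonneg S)) L hc hL
    (fun x => by rw [norm_abs_apply, norm_abs_apply]; exact h x) ht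

theorem schattenSum_mono {S T : H →L[ℂ] H} (hS : IsCompactOperator S)
    (h : ∀ x, ‖T x‖ ≤ ‖S x‖) {p : ℝ} (hp : 0 < p) : schattenSum p T ≤ schattenSum p S := by
  simpa using schattenSum_le_of_norm_le hS (isCompactOperator_of_norm_le hS h) 1 one_pos
    (fun x => by simp) h hp

theorem MemSchatten.of_norm_le {S T : H →L[ℂ] H} {p : ℝ} (hp : 0 < p) (hS : MemSchatten p S)
    (h : ∀ x, ‖T x‖ ≤ ‖S x‖) : MemSchatten p T :=
  ⟨isCompactOperator_of_norm_le hS.1 h, (schattenSum_mono hS.1 h hp).trans_lt hS.2⟩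

theorem MemSchatten.mul_right {S : H →L[ℂ] H} {p : ℝ} (hp : 0 < p) (hS : MemSchatten p S)
    (L : H →L[ℂ] H) : MemSchatten p (S * L) := by
  have hc : IsCompactOperator (S * L : H →L[ℂ] H) := hS.1.comp_clm L
  -- The added `1` keeps the constant positive when `L = 0`.
  refine ⟨hc, (schattenSum_le_of_norm_le hS.1 hc L (c := ‖L‖ + 1) (by positivity) ?_
    (fun x => le_rfl) hp).trans_lt (ENNReal.mul_lt_top ENNReal.ofReal_lt_top hS.2)⟩
  intro x
  exact (L.le_opNorm x).trans (by gcongr; linarith)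

theorem schattenNorm_mono {S T : H →L[ℂ] H} {p : ℝ} (hp : 0 < p) (hS : MemSchatten p S)
    (h : ∀ x, ‖T x‖ ≤ ‖S x‖) : schattenNorm p T ≤ schattenNorm p S :=
  Real.rpow_le_rpow ENNReal.toReal_nonneg
    (ENNReal.toReal_mono hS.2.ne (schattenSum_mono hS.1 h hp)) (by positivity)

/-! ### Douglas factorization and the normal equation -/

/-- Douglas' factorization lemma. -/
theorem exists_mul_eq_of_range_le {D Q : H →L[ℂ] H} (h : D.range ≤ Q.range) :
    ∃ Y : H →L[ℂ] H, Q * Y = D := by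
  -- Solutions in `(ker Q)ᗮ` are unique, which makes the choice linear; boundedness then follows
  -- from the closed graph theorem.
  have hex : ∀ x, ∃ z ∈ Q.kerᗮ, Q z = D x := by
    intro x
    obtain ⟨z, hz⟩ := h ⟨x, rfl⟩
    have hcl : IsClosed (Q.ker : Set H) := Q.isClosed_ker
    have : CompleteSpace Q.ker := hcl.completeSpace_coe
    refine ⟨z - Q.ker.starProjection z, Submodule.sub_starProjection_mem_orthogonal z, ?_⟩
    have h0 : Q (Q.ker.starProjection z) = 0 := Submodule.starProjection_apply_mem Q.ker z
    rw [map_sub, h0, sub_zero]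
    exact hz
  have huniq : ∀ z ∈ Q.kerᗮ, ∀ w ∈ Q.kerᗮ, Q z = Q w → z = w := by
    intro z hz w hw hzw
    have h1 : z - w ∈ Q.ker := by
      change Q (z - w) = 0
      rw [map_sub, hzw, sub_self]
    exact sub_eq_zero.1 (inner_self_eq_zero.1 ((Q.kerᗮ.sub_mem hz hw) _ h1))
  choose f hf hQf using hex
  let Y : H →ₗ[ℂ] H :=
    { toFun := f
      map_add' := fun x y => huniq _ (hf _) _ (Q.kerᗮ.add_mem (hf _) (hf _)) (by
        rw [map_add, hQf, hQf, hQf, map_add])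
      map_smul' := fun a x => huniq _ (hf _) _ (Q.kerᗮ.smul_mem _ (hf _)) (by
        rw [RingHom.id_apply, map_smul, hQf, hQf, map_smul]) }
  have hY : Continuous Y := by
    refine Y.continuous_of_seq_closed_graph fun u x y hu hy => ?_
    have hymem : y ∈ Q.kerᗮ := (Submodule.isClosed_orthogonal Q.ker).mem_of_tendsto hy
      (Filter.Eventually.of_forall fun n => hf (u n))
    refine huniq _ hymem _ (hf x) ?_
    refine Eq.trans ?_ (hQf x).symm
    have h1 : Filter.Tendsto (fun n => Q (f (u n))) Filter.atTop (nhds (Q y)) :=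
      (Q.continuous.tendsto y).comp hy
    simp only [hQf] at h1
    exact tendsto_nhds_unique h1 ((D.continuous.tendsto x).comp hu)
  exact ⟨⟨Y, hY⟩, ContinuousLinearMap.ext hQf⟩

/-- Closed range provides the orthogonal projection onto `R(B)`, which Douglas' lemma factors as `B
Z`. -/
theorem exists_generalized_inverse {B : H →L[ℂ] H} (hB : IsClosed (B.range : Set H)) :
    ∃ Z : H →L[ℂ] H, B * Z * B = B := by
  have : CompleteSpace B.range := hB.completeSpace_coe
  obtain ⟨Z, hZ⟩ := exists_mul_eq_of_range_le (D := B.range.starProjection) (Q := B) (by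
    rintro _ ⟨x, rfl⟩
    exact Submodule.starProjection_apply_mem B.range x)
  refine ⟨Z, ?_⟩
  rw [hZ]
  ext x
  exact Submodule.starProjection_eq_self_iff.2 ⟨x, rfl⟩

/-- The normal equation `Q X B = D` is solvable if `R(D) ⊆ R(Q)`, `N(B) ⊆ N(D)` and `B` has
closed range. -/
theorem exists_mul_mul_eq {B D Q : H →L[ℂ] H} (hB : IsClosed (B.range : Set H))
    (hker : B.ker ≤ D.ker) (hrange : D.range ≤ Q.range) : ∃ X : H →L[ℂ] H, Q * X * B = D := by
  obtain ⟨Y, hY⟩ := exists_mul_eq_of_range_le hrange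
  obtain ⟨Z, hZ⟩ := exists_generalized_inverse hB
  refine ⟨Y * Z, ?_⟩
  rw [← mul_assoc, hY]
  ext x
  -- `Z B x` and `x` differ by an element of `N(B)`, which `D` annihilates; hence `D Z B = D`.
  have h1 : Z (B x) - x ∈ D.ker := hker (by
    change B (Z (B x) - x) = 0
    rw [map_sub, sub_eq_zero]
    exact congrArg (fun T : H →L[ℂ] H => T x) hZ)
  have h2 : D (Z (B x) - x) = 0 := h1
  rw [map_sub, sub_eq_zero] at h2
  exact h2

/-! ### Square roots, shorted operators and `W`-orthogonality -/

theorem inner_self_apply_eq_norm_sqrt_sq {W : H →L[ℂ] H} (hW : 0 ≤ W) (x : H) :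
    (inner ℂ (W x) x).re = ‖CFC.sqrt W x‖ ^ 2 := by
  have hR := (ContinuousLinearMap.nonneg_iff_isPositive (CFC.sqrt W)).1 (CFC.sqrt_nonneg W)
  have h : W x = CFC.sqrt W (CFC.sqrt W x) :=
    (congrArg (fun T : H →L[ℂ] H => T x) (CFC.sqrt_mul_sqrt_self W hW)).symm
  rw [h, hR.inner_left_eq_inner_right, inner_self_eq_norm_sq_to_K]
  norm_cast

/-- With `P` the projection onto `(W^{1/2} S)ᗮ`, the operator `W^{1/2} P W^{1/2}` competes in the
maximum defining the shorted operator. -/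
theorem sqrt_mul_starProjection_mul_sqrt_mem_shortedSet {W : H →L[ℂ] H} (hW : 0 ≤ W)
    (S : Submodule ℂ H) :
    CFC.sqrt W * (S.map ((CFC.sqrt W : H →L[ℂ] H) : H →ₗ[ℂ] H))ᗮ.starProjection * CFC.sqrt W ∈
      shortedSet W S := by
  have hR := (ContinuousLinearMap.nonneg_iff_isPositive (CFC.sqrt W)).1 (CFC.sqrt_nonneg W)
  have hRR : W = CFC.sqrt W * CFC.sqrt W := (CFC.sqrt_mul_sqrt_self W hW).symm
  set R : H →L[ℂ] H := CFC.sqrt W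
  have hRs : star R = R := hR.isSelfAdjoint.star_eq
  set N : Submodule ℂ H := S.map (R : H →ₗ[ℂ] H)
  refine ⟨?_, ?_, ?_⟩
  · have h : (0 : H →L[ℂ] H) ≤ Nᗮ.starProjection := by
      rw [ContinuousLinearMap.nonneg_iff_isPositive]
      exact ContinuousLinearMap.IsPositive.of_isStarProjection isStarProjection_starProjection
    simpa [hRs] using star_left_conjugate_nonneg h R
  · have h : Nᗮ.starProjection ≤ (1 : H →L[ℂ] H) := isStarProjection_starProjection.le_one
    have h1 := star_left_conjugate_le_conjugate h R
    rwa [hRs, mul_one, ← hRR] at h1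
  · rintro _ ⟨x, rfl⟩
    rw [Submodule.mem_orthogonal']
    intro s hs
    have h1 : inner ℂ (R (Nᗮ.starProjection (R x))) s = inner ℂ (Nᗮ.starProjection (R x)) (R s) :=
      hR.inner_left_eq_inner_right _ _
    exact h1.trans (Submodule.inner_left_of_mem_orthogonal (Submodule.mem_map_of_mem hs)
      (Submodule.starProjection_apply_mem _ _))

/-- The shorted operator `M` annihilates `S`, so its quadratic form at `e + s` is that at `e`, and
`M ≤ W` bounds it above. Maximality of `M` bounds it below by the form of `W^{1/2} P W^{1/2}`, an
operator which sends `e + s` to `W e`. -/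
theorem norm_sqrt_shortedOperator_apply {W : H →L[ℂ] H} (hW : 0 ≤ W) {S : Submodule ℂ H} {e s : H}
    (he : e ∈ wOrthogonal W S) (hs : s ∈ S) :
    ‖CFC.sqrt (shortedOperator W S) (e + s)‖ = ‖CFC.sqrt W e‖ := by
  obtain ⟨⟨hM0, hMW, hMS⟩, hMmax⟩ := shortedOperator_isGreatest hW S
  have hR := (ContinuousLinearMap.nonneg_iff_isPositive (CFC.sqrt W)).1 (CFC.sqrt_nonneg W)
  have hle := hMmax (sqrt_mul_starProjection_mul_sqrt_mem_shortedSet hW S)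
  set M := shortedOperator W S
  have hMp := (ContinuousLinearMap.nonneg_iff_isPositive M).1 hM0
  have hMs : M s = 0 := (inner_self_eq_zero (𝕜 := ℂ)).1 (by
    rw [hMp.inner_left_eq_inner_right]
    exact Submodule.inner_right_of_mem_orthogonal hs (hMS ⟨M s, rfl⟩))
  have hMe : inner ℂ (M (e + s)) (e + s) = inner ℂ (M e) e := by
    rw [map_add, hMs, add_zero, inner_add_right, hMp.inner_left_eq_inner_right e s, hMs,
      inner_zero_right, add_zero]
  rw [← sq_eq_sq₀ (norm_nonneg _) (norm_nonneg _), ← inner_self_apply_eq_norm_sqrt_sq hM0,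
    ← inner_self_apply_eq_norm_sqrt_sq hW]
  refine le_antisymm ?_ ?_
  · rw [hMe]
    exact re_inner_le_of_le hMW e
  · refine le_trans (le_of_eq ?_) (re_inner_le_of_le hle (e + s))
    have hRe : CFC.sqrt W e ∈ (S.map ((CFC.sqrt W : H →L[ℂ] H) : H →ₗ[ℂ] H))ᗮ := by
      rw [Submodule.mem_orthogonal']
      rintro _ ⟨y, hy, rfl⟩
      have h1 := he y hy
      rw [← CFC.sqrt_mul_sqrt_self W hW] at h1
      exact (hR.inner_left_eq_inner_right _ _).symm.trans h1
    have hP : (S.map ((CFC.sqrt W : H →L[ℂ] H) : H →ₗ[ℂ] H))ᗮ.starProjection (CFC.sqrt W (e + s)) =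
        CFC.sqrt W e := by
      rw [map_add, map_add, Submodule.starProjection_eq_self_iff.2 hRe,
        (Submodule.starProjection_apply_eq_zero_iff _).2, add_zero]
      exact Submodule.le_orthogonal_orthogonal _ (Submodule.mem_map_of_mem hs)
    have h2 : (CFC.sqrt W * (S.map ((CFC.sqrt W : H →L[ℂ] H) : H →ₗ[ℂ] H))ᗮ.starProjection * CFC.sqrt W)
        (e + s) = W e := by
      refine (congrArg (CFC.sqrt W : H →L[ℂ] H) hP).trans ?_
      exact congrArg (fun T : H →L[ℂ] H => T e) (CFC.sqrt_mul_sqrt_self W hW)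
    rw [h2, inner_add_right, he s hs, add_zero]

/-- Pythagoras for the semi-inner product `⟪W x, y⟫`. -/
theorem norm_sqrt_le_norm_sqrt_add {W : H →L[ℂ] H} (hW : 0 ≤ W) {S : Submodule ℂ H} {e s : H}
    (he : e ∈ wOrthogonal W S) (hs : s ∈ S) : ‖CFC.sqrt W e‖ ≤ ‖CFC.sqrt W (e + s)‖ := by
  have hWp := (ContinuousLinearMap.nonneg_iff_isPositive W).1 hW
  have hes : inner ℂ (W e) s = 0 := he s hs
  have hse : inner ℂ (W s) e = 0 := by
    rw [hWp.inner_left_eq_inner_right, ← inner_conj_symm, hes, map_zero]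
  rw [← sq_le_sq₀ (norm_nonneg _) (norm_nonneg _), ← inner_self_apply_eq_norm_sqrt_sq hW,
    ← inner_self_apply_eq_norm_sqrt_sq hW, map_add, inner_add_left, inner_add_right,
    inner_add_right, hes, hse, add_zero, zero_add, Complex.add_re,
    inner_self_apply_eq_norm_sqrt_sq hW s]
  linarith [sq_nonneg ‖CFC.sqrt W s‖]

end Schatten

end WeightedLS

/-! ### The weighted least squares problem -/

theorem proposition4p1 {H : Type*} [NormedAddCommGroup H] [InnerProductSpace ℂ H]
    [CompleteSpace H] [TopologicalSpace.SeparableSpace H]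
    (A B C W : H →L[ℂ] H)
    (hA : IsClosed (A.range : Set H)) (hB : IsClosed (B.range : Set H))
    (hW : 0 ≤ W) (p : ℝ) (hp : 1 ≤ p)
    (hWp : WeightedLS.MemSchatten p (CFC.sqrt W))
    (hker : B.ker ≤ (ContinuousLinearMap.adjoint A * W * C).ker)
    (hrange : C.range ≤ A.range ⊔ WeightedLS.wOrthogonal W A.range) :
    (∀ X : H →L[ℂ] H, WeightedLS.MemSchatten p (CFC.sqrt W * (A * X * B - C))) ∧
    WeightedLS.MemSchatten p (CFC.sqrt (WeightedLS.shortedOperator W A.range) * C) ∧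
    ∃ X₀ : H →L[ℂ] H,
      IsLeast (Set.range fun X : H →L[ℂ] H =>
          WeightedLS.schattenSeminorm p W (A * X * B - C))
        (WeightedLS.schattenSeminorm p W (A * X₀ * B - C)) ∧
      WeightedLS.schattenSeminorm p W (A * X₀ * B - C) =
        WeightedLS.schattenNorm p
          (CFC.sqrt (WeightedLS.shortedOperator W A.range) * C) := by
  have hp0 : 0 < p := one_pos.trans_le hp
  have hmem : ∀ X : H →L[ℂ] H, WeightedLS.MemSchatten p (CFC.sqrt W * (A * X * B - C)) :=
    fun X => hWp.mul_right hp0 _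
  obtain ⟨X₀, hX₀⟩ := WeightedLS.exists_mul_mul_eq
    (Q := ContinuousLinearMap.adjoint A * W * A) hB hker (by
      rintro _ ⟨x, rfl⟩
      -- Write `C x = A a + n` with `n` `W`-orthogonal to `R(A)`; then `A* W n = 0`, so `a` is a
      -- preimage of `A* W C x`.
      obtain ⟨_, ⟨a, rfl⟩, n, hn, han⟩ := Submodule.mem_sup.1 (hrange ⟨x, rfl⟩)
      refine ⟨a, ?_⟩
      change ContinuousLinearMap.adjoint A (W (A a)) = ContinuousLinearMap.adjoint A (W (C x))
      have hn0 : ContinuousLinearMap.adjoint A (W n) = 0 := by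
        refine ext_inner_right ℂ fun y => ?_
        rw [ContinuousLinearMap.adjoint_inner_left, inner_zero_left]
        exact hn _ ⟨y, rfl⟩
      have han' : A a + n = C x := han
      rw [← han', map_add, map_add, hn0, add_zero])
  have hE : ∀ x, (A * X₀ * B - C) x ∈ WeightedLS.wOrthogonal W A.range := by
    rintro x _ ⟨y, rfl⟩
    have h1 : ContinuousLinearMap.adjoint A (W ((A * X₀ * B - C) x)) = 0 := by
      rw [sub_apply, map_sub, map_sub, sub_eq_zero]
      exact congrArg (fun T : H →L[ℂ] H => T x) hX₀
    refine (ContinuousLinearMap.adjoint_inner_left A y _).symm.trans ?_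
    rw [h1, inner_zero_left]
  have hshort : ∀ x, ‖(CFC.sqrt (WeightedLS.shortedOperator W A.range) * C) x‖ =
      ‖(CFC.sqrt W * (A * X₀ * B - C)) x‖ := by
    intro x
    -- Adding this element of `R(A)` to the residual leaves `-C x`.
    have h1 := WeightedLS.norm_sqrt_shortedOperator_apply hW (hE x)
      (s := -(A * X₀ * B) x) (A.range.neg_mem ⟨X₀ (B x), rfl⟩)
    have h2 : (A * X₀ * B - C) x + -(A * X₀ * B) x = -C x := by
      rw [sub_apply]
      abel
    rw [h2, map_neg, norm_neg] at h1
    exact h1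
  have hmemS := (hmem X₀).of_norm_le hp0 fun x => (hshort x).le
  refine ⟨hmem, hmemS, X₀, ⟨⟨X₀, rfl⟩, ?_⟩, ?_⟩
  · rintro _ ⟨X, rfl⟩
    refine WeightedLS.schattenNorm_mono hp0 (hmem X) fun x => ?_
    -- Uses `A X B - C = (A X₀ B - C) + A (X - X₀) B`.
    have h1 := WeightedLS.norm_sqrt_le_norm_sqrt_add hW (hE x)
      (s := A ((X - X₀) (B x))) ⟨(X - X₀) (B x), rfl⟩
    have h2 : (A * X₀ * B - C) x + A ((X - X₀) (B x)) = (A * X * B - C) x := by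
      change A (X₀ (B x)) - C x + A ((X - X₀) (B x)) = A (X (B x)) - C x
      rw [sub_apply, map_sub]
      abel
    rw [h2] at h1
    exact h1
  · exact le_antisymm
      (WeightedLS.schattenNorm_mono hp0 hmemS fun x => (hshort x).ge)
      (WeightedLS.schattenNorm_mono hp0 (hmem X₀) fun x => (hshort x).le)
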